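/- **Proposition 4 (Asymptotic consistency of the Direct SAA).** Let $\mathcal X\subseteq\mathbb R^d$ be the feature space, let $\mathcal X^a,\mathcal X^p\subseteq\mathcal X$ be the actionable and the plausible domain, and suppose that $D=\mathcal X^a\cap\mathcal X^p$ is closed. Let $f(\cdot,x_{n+1})$ be a cost function that is continuous on $D$ and has bounded sublevel sets in $D$ (for instance a weighted $\ell_1$ distance to $x_{n+1}$, or any continuous cost when $D$ is compact). Let $\xi$ be the random training parameter, with law $P$, of a base learner $t(\cdot;\xi):\mathcal X\to\{0,1\}$ that is *convex*: there is a function $g$, with $g(\cdot,\xi)$ convex and real-valued on $\mathbb R^d$ for every $\xi$ and $g(x,\cdot)$ measurable for every $x$, such that $t(x;\xi)=1\iff g(x,\xi)\le 0$ for all $x\in\mathcal X$ (e.g. decision stumps, $g(x,\xi)=A(\xi)^\top x-b(\xi)$, or input-convex networks). Put $p(x)=P(t(x;\xi)=1)$. For $N\ge1$ let $h_N(x;\boldsymbol\xi)=\frac1N\sum_{i=1}^N t(x;\xi_i)$, and let $T(x;\boldsymbol\xi)=1$ if $h_N(x;\boldsymbol\xi)\ge 1/2$ and $T(x;\boldsymbol\xi)=0$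 otherwise. Fix $\alpha\in(0,1)$ and let $p^*_{N,\alpha}\in[0,1]$ be the solution $p$ of $B(N/2;N,p)=\alpha$, where $B(\cdot;N,p)$ is the c.d.f. of the binomial distribution $\mathrm{Bin}(N,p)$. Let $\xi^0_1,\xi^0_2,\dots$ be i.i.d. with law $P$, and let $h^0_N(x)=h_N(x;\xi^0_1,\dots,\xi^0_N)$ be the score of the given trained ensemble. Consider * the robust problem of size $N$: minimize $f(x,x_{n+1})$ over $x\in D$ with $\mathbb P_{\boldsymbol\xi}(T(x;\boldsymbol\xi)=1)\ge 1-\alpha$, where $\boldsymbol\xi\sim P^{\otimes N}$; its solutions are the minimum-cost robust counterfactual explanations; * the Direct SAA problem of size $N$: minimize $f(x,x_{n+1})$ over $x\in D$ with $h^0_N(x)\ge p^*_{N,\alpha}$; * the limit problem: minimize $f(x,x_{n+1})$ over $x\in D$ with $p(x)\ge 1/2$; let $S$ be its set of solutions. Assume the usual regularity condition of sample average approximation for chance constraints: some $\bar x\in S$ is a limit of points $x\in D$ with $p(x)>1/2$. Then $p^*_{N,\alpha}\to1/2$ as $N\to\infty$, the robust problem has a solution for all large $N$, and almost surely the following hold: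 the Direct SAA problem has a solution for all large $N$, and for every choice, for all large $N$, of solutions $\hat x_N$ of the Direct SAA problem and $x^*_N$ of the robust problem, as $N\to\infty$, $$f(\hat x_N,x_{n+1})-f(x^*_N,x_{n+1})\to0,\qquad \operatorname{dist}(\hat x_N,S)\to0,\qquad \operatorname{dist}(x^*_N,S)\to0,$$ and, if the limit problem has only one solution, $\|\hat x_N-x^*_N\|\to0$ (so that both converge to that solution). -/

import Mathlib

open MeasureTheory ProbabilityTheory Filter Topology

namespace RobustCE

noncomputable section

/-- The feature vectors live in `ℝ^d`. -/
abbrev Feat (d : ℕ) : Type := EuclideanSpace ℝ (Fin d)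

/-- A base learner `t` (with prediction `t x ξ ∈ {0, 1}`, where `ξ` parameterizes its random
training) is convex on the feature space `𝒳` if, for every realization of the training, predicting
the target class `1` is a convex constraint `g (x, ξ) ≤ 0` on the features: `g (·, ξ)` is a
real-valued convex function on `ℝ^d`, and `g (x, ·)` is measurable. For a decision stump
`g (x, ξ) = A(ξ)ᵀ x - b(ξ)`; for an input-convex neural network `g` is the output of the network. -/
def IsConvexLearner {d : ℕ} {Ξ : Type*} [MeasurableSpace Ξ]
    (𝒳 : Set (Feat d)) (t : Feat d → Ξ → Fin 2) : Prop :=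
  ∃ g : Feat d → Ξ → ℝ,
    (∀ ξ, ConvexOn ℝ Set.univ (fun x => g x ξ)) ∧
    (∀ x, Measurable (g x)) ∧
    ∀ x ∈ 𝒳, ∀ ξ, t x ξ = 1 ↔ g x ξ ≤ 0

/-- The score `h_N(x; ξ) = (1/N) ∑ i, t(x; ξ_i)` of an ensemble of `N` base learners. -/
def score {d : ℕ} {Ξ : Type*} (t : Feat d → Ξ → Fin 2) {N : ℕ} (x : Feat d)
    (ξ : Fin N → Ξ) : ℝ :=
  (1 / (N : ℝ)) * ∑ i, ((t x (ξ i)).val : ℝ)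

/-- The majority vote `T(x; ξ)` of the ensemble. -/
def ensemble {d : ℕ} {Ξ : Type*} (t : Feat d → Ξ → Fin 2) {N : ℕ} (x : Feat d)
    (ξ : Fin N → Ξ) : Fin 2 :=
  if 1 / 2 ≤ score t x ξ then 1 else 0

/-- The cumulative distribution function `B(y; N, p)` of the binomial distribution `Bin(N, p)`. -/
def binomCDF (y : ℝ) (N : ℕ) (p : ℝ) : ℝ :=
  ∑ k ∈ Finset.range (N + 1) with ((k : ℕ) : ℝ) ≤ y,
    (N.choose k : ℝ) * p ^ k * (1 - p) ^ (N - k)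

/-- The map `g_N : p ↦ B(N/2; N, p)`. -/
def gMap (N : ℕ) (p : ℝ) : ℝ := binomCDF ((N : ℝ) / 2) N p

/-- The robustness threshold `p*_{N,α} = g_N⁻¹(α)`, where `g_N : [0,1] → [0,1]`. -/
def pStar (N : ℕ) (α : ℝ) : ℝ := Function.invFunOn (gMap N) (Set.Icc 0 1) α

/-- `p(x)`, the probability that a newly trained base learner predicts the target class at `x`;
`P` is the law of the random training parameter. -/
def learnerProb {d : ℕ} {Ξ : Type*} [MeasurableSpace Ξ] (P : Measure Ξ)
    (t : Feat d → Ξ → Fin 2) (x : Feat d) : ℝ :=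
  P.real {ξ | t x ξ = 1}

/-- The minimizers of the cost `c` over the feasible set `F`. -/
def argmin {d : ℕ} (c : Feat d → ℝ) (F : Set (Feat d)) : Set (Feat d) :=
  {x | x ∈ F ∧ ∀ y ∈ F, c x ≤ c y}

/-- The points of the domain `D` that are robust with tolerance `α`: a newly trained ensemble of
`N` independent base learners predicts class `1` there with probability at least `1 - α`. -/
def robustSet {d : ℕ} {Ξ : Type*} [MeasurableSpace Ξ] (P : Measure Ξ)
    (t : Feat d → Ξ → Fin 2) (D : Set (Feat d)) (α : ℝ) (N : ℕ) : Set (Feat d) :=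
  {x | x ∈ D ∧ 1 - α ≤
    (Measure.pi (fun _ : Fin N => P)).real {ξ | ensemble t x ξ = 1}}

/-- The feasible set of the Direct SAA problem for the trained ensemble
with parameters `ξ₀ 0, …, ξ₀ (N - 1)`. -/
def saaSet {d : ℕ} {Ξ : Type*} (t : Feat d → Ξ → Fin 2) (D : Set (Feat d)) (α : ℝ)
    (ξ₀ : ℕ → Ξ) (N : ℕ) : Set (Feat d) :=
  {x | x ∈ D ∧ pStar N α ≤ score t x (fun i : Fin N => ξ₀ i)}

/-- The feasible set of the large-ensemble limit of the robust problem: a base learner predicts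
class `1` with probability at least `1/2`, the limit of `pStar N α` as `N → ∞`. -/
def limitSet {d : ℕ} {Ξ : Type*} [MeasurableSpace Ξ] (P : Measure Ξ)
    (t : Feat d → Ξ → Fin 2) (D : Set (Feat d)) : Set (Feat d) :=
  {x | x ∈ D ∧ 1 / 2 ≤ learnerProb P t x}

end

end RobustCE

namespace RobustCE

/-! In the limit both problems accept the points with `p > 1/2` and reject those with `p < 1/2`. For
the SAA this is the law of large numbers together with `pStar N α → 1/2`, which Chebyshev's
inequality yields. For the robust problem, the probability of a majority tends to 1 or to 0, so
every `α` strictly between gives the same limit.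

Rejection must hold on a whole neighbourhood. `exists_nhds_learner_subset` covers the acceptance
events of all points near `x` by one event of probability below 1/2, and one law of large numbers
for that event suffices. Convexity enters through the continuity of `g (·, ξ)`.

`argmin_consistent` turns these facts into convergence: strictly feasible points near `xbar` bound
the cost from above, and compact sublevel sets make local rejection uniform. Points with `p = 1/2`
need no separate control, as they lie in the limit set. -/

/-! ### Minimizers over converging feasible sets -/

section Argmin

variable {d : ℕ} {c : Feat d → ℝ} {D : Set (Feat d)}

/-- A sequence leaves a compact set eventually, if it eventually leaves a neighbourhood within the
set of each of its points. -/
theorem eventually_notMem_of_isCompact {X : Type*} [TopologicalSpace X] {K : Set X}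
    (hK : IsCompact K) {x : ℕ → X}
    (h : ∀ y ∈ K, ∃ U ∈ 𝓝[K] y, ∀ᶠ N in atTop, x N ∉ U) : ∀ᶠ N in atTop, x N ∉ K := by
  refine hK.induction_on (p := fun s => ∀ᶠ N in atTop, x N ∉ s) (by simp) ?_ ?_ h
  · exact fun s t hst ht => ht.mono fun N hN hs => hN (hst hs)
  · intro s t hs ht
    filter_upwards [hs, ht] with N h1 h2
    simp [h1, h2]

theorem isCompact_sublevel (hD : IsClosed D) (hc : ContinuousOn c D)
    (hb : ∀ r : ℝ, Bornology.IsBounded {x | x ∈ D ∧ c x ≤ r}) (r : ℝ) :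
    IsCompact {x | x ∈ D ∧ c x ≤ r} :=
  Metric.isCompact_of_isClosed_isBounded
    (hc.preimage_isClosed_of_isClosed hD isClosed_Iic) (hb r)

theorem argmin_nonempty (hD : IsClosed D) (hc : ContinuousOn c D)
    (hb : ∀ r : ℝ, Bornology.IsBounded {x | x ∈ D ∧ c x ≤ r}) {F : Set (Feat d)}
    (hFD : F ⊆ D) (hF : IsClosed F) (hne : F.Nonempty) : (argmin c F).Nonempty := by
  obtain ⟨y, hy⟩ := hne
  have hK : IsCompact ({x | x ∈ D ∧ c x ≤ c y} ∩ F) :=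
    (isCompact_sublevel hD hc hb (c y)).inter_right hF
  obtain ⟨z, ⟨⟨-, hzy⟩, hzF⟩, hmin⟩ := hK.exists_isMinOn ⟨y, ⟨hFD hy, le_rfl⟩, hy⟩
    (hc.mono fun x hx => hFD hx.2)
  refine ⟨z, hzF, fun w hw => ?_⟩
  rcases le_total (c w) (c y) with h | h
  · exact hmin ⟨⟨hFD hw, h⟩, hw⟩
  · exact hzy.trans h

/-- Consistency of minimizers: the feasible sets `F N` eventually contain points arbitrarily close
to a minimizer over `L`, and are eventually locally disjoint from the complement of `L`. -/
theorem argmin_consistent (hD : IsClosed D) (hc : ContinuousOn c D)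
    (hb : ∀ r : ℝ, Bornology.IsBounded {x | x ∈ D ∧ c x ≤ r}) {F : ℕ → Set (Feat d)}
    (hFD : ∀ N, F N ⊆ D) (hF : ∀ N, IsClosed (F N)) {L : Set (Feat d)} {xbar : Feat d}
    (hLD : L ⊆ D) (hxbar : xbar ∈ argmin c L)
    (hin : xbar ∈ closure {y | y ∈ D ∧ ∀ᶠ N in atTop, y ∈ F N})
    (hout : ∀ x ∈ D, x ∉ L → ∃ U ∈ 𝓝 x, ∀ᶠ N in atTop, ∀ y ∈ U, y ∉ F N) :
    (∀ᶠ N in atTop, (argmin c (F N)).Nonempty) ∧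
    ∀ x : ℕ → Feat d, (∀ᶠ N in atTop, x N ∈ argmin c (F N)) →
      Tendsto (fun N => c (x N)) atTop (𝓝 (c xbar)) ∧
      Tendsto (fun N => Metric.infDist (x N) (argmin c L)) atTop (𝓝 0) := by
  constructor
  · obtain ⟨y, -, hy⟩ : {y | y ∈ D ∧ ∀ᶠ N in atTop, y ∈ F N}.Nonempty :=
      closure_nonempty_iff.1 ⟨_, hin⟩
    filter_upwards [hy] with N hN using argmin_nonempty hD hc hb (hFD N) (hF N) ⟨y, hN⟩
  intro x hx
  -- Minimizers cost no more than an eventually feasible point close to `xbar`.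
  have hupper : ∀ b, c xbar < b → ∀ᶠ N in atTop, c (x N) < b := by
    intro b hbv
    have hnhds : {y | c y < b} ∈ 𝓝[D] xbar :=
      (hc xbar (hLD hxbar.1)).eventually (Iio_mem_nhds hbv)
    obtain ⟨V, hV, hVb⟩ := mem_nhdsWithin_iff_exists_mem_nhds_inter.1 hnhds
    obtain ⟨y, hyV, hyD, hyF⟩ := mem_closure_iff_nhds.1 hin V hV
    filter_upwards [hyF, hx] with N hN hxN
    exact (hxN.2 y hN).trans_lt (hVb ⟨hyV, hyD⟩)
  have hxD : ∀ᶠ N in atTop, x N ∈ D := hx.mono fun N hN => hFD N hN.1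
  have hexcl : ∀ y ∈ D, y ∉ L → ∀ K : Set (Feat d), ∃ U ∈ 𝓝[K] y, ∀ᶠ N in atTop, x N ∉ U := by
    intro y hyD hyL K
    obtain ⟨U, hU, hUN⟩ := hout y hyD hyL
    refine ⟨U, mem_nhdsWithin_of_mem_nhds hU, ?_⟩
    filter_upwards [hUN, hx] with N h1 h2 h3 using h1 _ h3 h2.1
  constructor
  · refine tendsto_order.2 ⟨fun a ha => ?_, hupper⟩
    -- A sublevel set below the optimal value misses `L`, so the minimizers leave it locally at each
    -- point.
    have := eventually_notMem_of_isCompact (x := x) (isCompact_sublevel hD hc hb a)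
      fun y hy => hexcl y hy.1 (fun hL => absurd (hxbar.2 y hL) (not_le.2 (hy.2.trans_lt ha))) _
    filter_upwards [this, hxD] with N h1 h2
    exact not_le.1 fun h => h1 ⟨h2, h⟩
  · refine tendsto_order.2 ⟨fun a ha => ?_, fun ε hε => ?_⟩
    · exact Eventually.of_forall fun N => ha.trans_le Metric.infDist_nonneg
    -- The slack 1 is arbitrary: any level above `c xbar` eventually traps the minimizers in a
    -- compact set.
    have hK : IsCompact ({y | y ∈ D ∧ c y ≤ c xbar + 1} ∩
        {y | ε ≤ Metric.infDist y (argmin c L)}) :=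
      (isCompact_sublevel hD hc hb _).inter_right
        (isClosed_le continuous_const (Metric.continuous_infDist_pt _))
    have := eventually_notMem_of_isCompact (x := x) hK ?_
    · filter_upwards [this, hxD, hupper (c xbar + 1) (by linarith)] with N h1 h2 h3
      exact not_le.1 fun h => h1 ⟨⟨h2, h3.le⟩, h⟩
    rintro y ⟨⟨hyD, -⟩, hyε⟩
    -- Inside `L`, a point away from the minimizers is excluded by its cost; outside `L`, by local
    -- infeasibility.
    by_cases hyL : y ∈ L
    · have hlt : c xbar < c y := by
        by_contra! hle
        have : y ∈ argmin c L := ⟨hyL, fun z hz => hle.trans (hxbar.2 z hz)⟩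
        have h0 := Metric.infDist_zero_of_mem this
        exact absurd hyε (not_le.2 (h0 ▸ hε))
      obtain ⟨b, hb1, hb2⟩ := exists_between hlt
      refine ⟨{z | b < c z}, nhdsWithin_mono _ (fun z hz => hz.1.1)
        ((hc y hyD).eventually (Ioi_mem_nhds hb2)), ?_⟩
      filter_upwards [hupper b hb1] with N hN using not_lt.2 hN.le
    · exact hexcl y hyD hyL _

end Argmin

/-! ### The robustness threshold -/

section Threshold

open unitInterval

theorem gMap_eq_sum_bernstein (N : ℕ) (p : I) :
    gMap N p = ∑ k : Fin (N + 1), if ((k : ℕ) : ℝ) ≤ N / 2 then bernstein N k p else 0 := by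
  simp only [gMap, binomCDF, bernstein_apply]
  rw [Finset.sum_filter, Finset.sum_range]

/-- Chebyshev's inequality for the binomial distribution. -/
theorem sum_bernstein_le {N : ℕ} (hN : N ≠ 0) (p : I) {δ : ℝ} (hδ : 0 < δ) (q : ℕ → Prop)
    [DecidablePred q] (hq : ∀ k, q k → δ ≤ |(p : ℝ) - k / N|) :
    (∑ k : Fin (N + 1), if q k then bernstein N k p else 0) ≤ 1 / (N * δ ^ 2) := by
  have hN' : (0 : ℝ) < N := by positivity
  have hvar := bernstein.variance hN p
  have hle : δ ^ 2 * (∑ k : Fin (N + 1), if q k then bernstein N k p else 0) ≤ 1 / N := by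
    calc _ ≤ ∑ k : Fin (N + 1), ((p : ℝ) - bernstein.z k) ^ 2 * bernstein N k p := by
          rw [Finset.mul_sum]
          refine Finset.sum_le_sum fun k _ => ?_
          split_ifs with h
          · refine mul_le_mul_of_nonneg_right ?_ bernstein_nonneg
            have := hq k h
            rw [← sq_abs ((p : ℝ) - _)]
            exact pow_le_pow_left₀ hδ.le this 2
          · rw [mul_zero]
            exact mul_nonneg (sq_nonneg _) bernstein_nonneg
      _ = (p : ℝ) * (1 - p) / N := hvar
      _ ≤ 1 / N := by
          gcongr
          nlinarith [p.2.1, p.2.2]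
  rw [le_div_iff₀ (by positivity)]
  rw [le_div_iff₀ hN'] at hle
  linarith

theorem gMap_le {N : ℕ} (hN : N ≠ 0) (p : I) {δ : ℝ} (hδ : 0 < δ) (hp : 1 / 2 + δ ≤ (p : ℝ)) :
    gMap N p ≤ 1 / (N * δ ^ 2) := by
  rw [gMap_eq_sum_bernstein]
  refine sum_bernstein_le hN p hδ (fun k => (k : ℝ) ≤ N / 2) fun k hk => ?_
  have hN' : (0 : ℝ) < N := by positivity
  have : (k : ℝ) / N ≤ 1 / 2 := by
    rw [div_le_iff₀ hN']; linarith
  exact le_trans (by linarith) (le_abs_self _)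

theorem le_gMap {N : ℕ} (hN : N ≠ 0) (p : I) {δ : ℝ} (hδ : 0 < δ) (hp : (p : ℝ) ≤ 1 / 2 - δ) :
    1 - 1 / (N * δ ^ 2) ≤ gMap N p := by
  have hN' : (0 : ℝ) < N := by positivity
  have h := sum_bernstein_le hN p hδ (fun k => ¬ (k : ℝ) ≤ N / 2) fun k hk => by
    have : 1 / 2 ≤ (k : ℝ) / N := by
      rw [le_div_iff₀ hN']; linarith
    exact le_trans (by linarith) (neg_le_abs _)
  have hsum : gMap N p + (∑ k : Fin (N + 1),
      if ¬ ((k : ℕ) : ℝ) ≤ N / 2 then bernstein N k p else 0) = 1 := by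
    rw [gMap_eq_sum_bernstein, ← Finset.sum_add_distrib, ← bernstein.probability N p]
    refine Finset.sum_congr rfl fun k _ => ?_
    split_ifs <;> simp
  linarith

theorem gMap_continuous (N : ℕ) : Continuous (gMap N) := by
  unfold gMap binomCDF
  fun_prop

theorem gMap_zero (N : ℕ) : gMap N 0 = 1 := by
  unfold gMap binomCDF
  rw [Finset.sum_eq_single_of_mem 0]
  · simp
  · simp; positivity
  · intro k _ hk
    simp [hk]

/-- All mass sits at `k = N`, which exceeds `N / 2` only because `N ≠ 0`. -/
theorem gMap_one {N : ℕ} (hN : N ≠ 0) : gMap N 1 = 0 := by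
  unfold gMap binomCDF
  refine Finset.sum_eq_zero fun k hk => ?_
  simp only [Finset.mem_filter, Finset.mem_range] at hk
  have hN' : (0 : ℝ) < N := by positivity
  have : k < N := by
    have : (k : ℝ) < N := by linarith [hk.2]
    exact_mod_cast this
  simp [Nat.sub_ne_zero_of_lt this]

/-- The intermediate value theorem ensures that `invFunOn` returns a true preimage, not its default
value. Uniqueness of the preimage plays no role. -/
theorem pStar_spec {N : ℕ} (hN : N ≠ 0) {α : ℝ} (hα0 : 0 ≤ α) (hα1 : α ≤ 1) :
    pStar N α ∈ Set.Icc (0 : ℝ) 1 ∧ gMap N (pStar N α) = α := by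
  have : α ∈ gMap N '' Set.Icc 0 1 :=
    intermediate_value_Icc' zero_le_one (gMap_continuous N).continuousOn
      (by rw [gMap_zero, gMap_one hN]; exact ⟨hα0, hα1⟩)
  exact Function.invFunOn_pos this

/-- For large `N`, `gMap N` is above `α` left of `1/2 - δ` and below `α` right of `1/2 + δ`, so `α`
is attained only in between. -/
theorem tendsto_pStar {α : ℝ} (hα0 : 0 < α) (hα1 : α < 1) :
    Tendsto (fun N => pStar N α) atTop (𝓝 (1 / 2)) := by
  rw [Metric.tendsto_nhds]
  intro δ hδ
  have hlim : Tendsto (fun N : ℕ => 1 / ((N : ℝ) * δ ^ 2)) atTop (𝓝 0) := by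
    simp only [one_div]
    exact (tendsto_natCast_atTop_atTop.atTop_mul_const (by positivity)).inv_tendsto_atTop
  filter_upwards [hlim.eventually (Iio_mem_nhds hα0),
    hlim.eventually (Iio_mem_nhds (sub_pos.2 hα1)), eventually_ne_atTop 0] with N h1 h2 hN
  obtain ⟨hmem, heq⟩ := pStar_spec hN hα0.le hα1.le
  rw [Real.dist_eq, abs_lt]
  constructor
  · by_contra! h
    have := le_gMap hN ⟨_, hmem⟩ hδ (by simpa using (by linarith : pStar N α ≤ 1 / 2 - δ))
    simp only [heq] at this
    linarith
  · by_contra! h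
    have := gMap_le hN ⟨_, hmem⟩ hδ (by simpa using (by linarith : 1 / 2 + δ ≤ pStar N α))
    simp only [heq] at this
    linarith

end Threshold

/-! ### Empirical frequencies -/

section Frequency

variable {Ξ Ω : Type*}

/-- The fraction of the parameters `ξ i` that lie in `A`. -/
noncomputable def freq (A : Set Ξ) {N : ℕ} (ξ : Fin N → Ξ) : ℝ :=
  (1 / (N : ℝ)) * ∑ i, A.indicator (fun _ => (1 : ℝ)) (ξ i)

theorem score_eq_freq {d : ℕ} (t : Feat d → Ξ → Fin 2) {N : ℕ} (x : Feat d) (ξ : Fin N → Ξ) :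
    score t x ξ = freq {ζ | t x ζ = 1} ξ := by
  unfold score freq
  congr 1
  refine Finset.sum_congr rfl fun i _ => ?_
  by_cases h : t x (ξ i) = 1
  · simp [h]
  · have h0 : t x (ξ i) = 0 := by omega
    simp [h0]

/-- The inclusion is asked only at the sampled points: `eventually_score_le` has it for finitely
many learners at a time. -/
theorem freq_mono {N : ℕ} {A B : Set Ξ} {ξ : Fin N → Ξ} (h : ∀ i, ξ i ∈ A → ξ i ∈ B) :
    freq A ξ ≤ freq B ξ := by
  unfold freq
  refine mul_le_mul_of_nonneg_left (Finset.sum_le_sum fun i _ => ?_) (by positivity)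
  by_cases hA : ξ i ∈ A
  · simp [hA, h i hA]
  · rw [Set.indicator_of_notMem hA]
    exact Set.indicator_nonneg (fun _ _ => zero_le_one) _

variable [MeasurableSpace Ξ] [MeasurableSpace Ω]

theorem measurable_freq {A : Set Ξ} (hA : MeasurableSet A) {N : ℕ} :
    Measurable (fun ξ : Fin N → Ξ => freq A ξ) := by
  unfold freq
  refine Measurable.const_mul (Finset.measurable_sum _ fun i _ => ?_) _
  exact (measurable_const.indicator hA).comp (measurable_pi_apply i)

/-- The strong law of large numbers for empirical frequencies. -/
theorem tendsto_freq {P : Measure Ξ} {μ : Measure Ω} [IsProbabilityMeasure μ] {ξ₀ : ℕ → Ω → Ξ}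
    (hlaw : ∀ i, HasLaw (ξ₀ i) P μ) (hindep : iIndepFun ξ₀ μ) {A : Set Ξ}
    (hA : MeasurableSet A) :
    ∀ᵐ ω ∂μ, Tendsto (fun N : ℕ => freq A (fun i : Fin N => ξ₀ i ω)) atTop (𝓝 (P.real A)) := by
  have hm : Measurable (A.indicator fun _ => (1 : ℝ)) := measurable_const.indicator hA
  have hid : ∀ i, IdentDistrib (A.indicator (fun _ => (1 : ℝ)) ∘ ξ₀ i)
      (A.indicator (fun _ => (1 : ℝ)) ∘ ξ₀ 0) μ μ := fun i =>
    IdentDistrib.comp ⟨(hlaw i).aemeasurable, (hlaw 0).aemeasurable,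
      (hlaw i).map_eq.trans (hlaw 0).map_eq.symm⟩ hm
  have hint : Integrable (A.indicator (fun _ => (1 : ℝ)) ∘ ξ₀ 0) μ := by
    refine Integrable.of_bound (hid 0).aemeasurable_fst.aestronglyMeasurable 1 (ae_of_all _ ?_)
    intro ω
    exact (norm_indicator_le_norm_self _ _).trans (by simp)
  have hmean : ∫ ω, (A.indicator (fun _ => (1 : ℝ)) ∘ ξ₀ 0) ω ∂μ = P.real A := by
    have := integral_map (hlaw 0).aemeasurable
      (f := A.indicator fun _ => (1 : ℝ)) hm.aestronglyMeasurable
    rw [(hlaw 0).map_eq, integral_indicator_const _ hA] at this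
    simpa using this.symm
  have hlln := strong_law_ae_real _ hint
    (fun i j hij => (hindep.comp (fun _ => A.indicator fun _ => (1 : ℝ)) fun _ => hm).indepFun hij)
    hid
  rw [hmean] at hlln
  filter_upwards [hlln] with ω hω
  refine hω.congr fun N => ?_
  simp only [freq, Function.comp_apply]
  rw [Finset.sum_range, div_eq_inv_mul, one_div]

theorem hasLaw_eval_infinitePi (P : Measure Ξ) [IsProbabilityMeasure P] (i : ℕ) :
    HasLaw (fun ζ : ℕ → Ξ => ζ i) P (Measure.infinitePi fun _ : ℕ => P) :=
  ⟨(measurable_pi_apply i).aemeasurable, Measure.infinitePi_map_eval _ i⟩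

theorem iIndepFun_eval_infinitePi (P : Measure Ξ) [IsProbabilityMeasure P] :
    iIndepFun (fun (i : ℕ) (ζ : ℕ → Ξ) => ζ i) (Measure.infinitePi fun _ : ℕ => P) :=
  iIndepFun_infinitePi (X := fun _ ξ => ξ) fun _ => measurable_id

/-- The weak law of large numbers: events that depend on the first `N` parameters and almost surely
stop occurring along an infinite sample have vanishing probability. -/
theorem tendsto_pi_of_ae_eventually_notMem (P : Measure Ξ) [IsProbabilityMeasure P]
    {E : ∀ N : ℕ, Set (Fin N → Ξ)} (hE : ∀ N, MeasurableSet (E N))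
    (h : ∀ᵐ ζ ∂Measure.infinitePi (fun _ : ℕ => P), ∀ᶠ N in atTop, (fun i : Fin N => ζ i) ∉ E N) :
    Tendsto (fun N => (Measure.pi (fun _ : Fin N => P)).real (E N)) atTop (𝓝 0) := by
  have hm : ∀ N : ℕ, Measurable fun (ζ : ℕ → Ξ) (i : Fin N) => ζ i := fun N => by fun_prop
  -- Pulled back to one infinite product, the events have indicators tending to 0 almost surely,
  -- hence measures tending to 0.
  have hlim := tendsto_measure_of_ae_tendsto_indicator_of_isFiniteMeasure
    (μ := Measure.infinitePi (fun _ : ℕ => P)) atTop (A := ∅)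
    (As := fun N => (fun (ζ : ℕ → Ξ) (i : Fin N) => ζ i) ⁻¹' E N) MeasurableSet.empty
    (fun N => hm N (hE N)) (by
      filter_upwards [h] with ζ hζ
      filter_upwards [hζ] with N hN
      simpa using hN)
  have heq : ∀ N, Measure.infinitePi (fun _ : ℕ => P)
      ((fun (ζ : ℕ → Ξ) (i : Fin N) => ζ i) ⁻¹' E N) = Measure.pi (fun _ : Fin N => P) (E N) := by
    intro N
    have hl : HasLaw (fun (ζ : ℕ → Ξ) (i : Fin N) => ζ i) (Measure.pi (fun _ : Fin N => P))
        (Measure.infinitePi (fun _ : ℕ => P)) :=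
      iIndepFun.hasLaw_pi (X := fun (i : Fin N) (ζ : ℕ → Ξ) => ζ i)
        (fun i => (hasLaw_eval_infinitePi P i))
        ((iIndepFun_eval_infinitePi P).precomp Fin.val_injective)
    exact hl.measure_eq (hE N)
  simp only [heq, measure_empty] at hlim
  simpa [measureReal_def, Function.comp_def] using (ENNReal.tendsto_toReal ENNReal.zero_ne_top).comp hlim

end Frequency

/-! ### Learners with a continuous constraint function -/

section Learner

variable {d : ℕ} {Ξ : Type*} {D : Set (Feat d)} {t : Feat d → Ξ → Fin 2}
  {g : Feat d → Ξ → ℝ}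

theorem setOf_ensemble_eq_one (t : Feat d → Ξ → Fin 2) {N : ℕ} (x : Feat d) :
    {ξ : Fin N → Ξ | ensemble t x ξ = 1} = {ξ | 1 / 2 ≤ freq {ζ | t x ζ = 1} ξ} := by
  ext ξ
  simp only [ensemble, score_eq_freq, Set.mem_ofPred_eq]
  split_ifs with h
  · exact iff_of_true rfl h
  · exact iff_of_false zero_ne_one h

/-- Rejection `g > 0` is an open condition, so the finitely many learners rejecting `x` still reject
nearby: the score is upper semicontinuous on `D`. -/
theorem eventually_score_le (hg : ∀ ξ, Continuous fun x => g x ξ)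
    (htg : ∀ x ∈ D, ∀ ξ, t x ξ = 1 ↔ g x ξ ≤ 0) {x : Feat d} (hx : x ∈ D) {N : ℕ}
    (ξ : Fin N → Ξ) : ∀ᶠ y in 𝓝[D] x, score t y ξ ≤ score t x ξ := by
  have h : ∀ i, ∀ᶠ y in 𝓝[D] x, t y (ξ i) = 1 → t x (ξ i) = 1 := by
    intro i
    by_cases hi : t x (ξ i) = 1
    · exact Eventually.of_forall fun _ _ => hi
    · rw [htg x hx, not_le] at hi
      filter_upwards [self_mem_nhdsWithin, mem_nhdsWithin_of_mem_nhds
        ((hg (ξ i)).continuousAt.eventually (Ioi_mem_nhds hi))] with y hy hpos h1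
      exact absurd ((htg y hy _).1 h1) (not_le.2 hpos)
  filter_upwards [eventually_all.2 h] with y hy
  rw [score_eq_freq, score_eq_freq]
  exact freq_mono hy

theorem isClosed_le_score (hD : IsClosed D) (hg : ∀ ξ, Continuous fun x => g x ξ)
    (htg : ∀ x ∈ D, ∀ ξ, t x ξ = 1 ↔ g x ξ ≤ 0) (r : ℝ) {N : ℕ} (ξ : Fin N → Ξ) :
    IsClosed {x | x ∈ D ∧ r ≤ score t x ξ} := by
  refine IsSeqClosed.isClosed fun x y hx hxy => ?_
  have hyD : y ∈ D := hD.mem_of_tendsto hxy (Eventually.of_forall fun n => (hx n).1)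
  have hev := (tendsto_nhdsWithin_iff.2 ⟨hxy, Eventually.of_forall fun n => (hx n).1⟩).eventually
    (eventually_score_le hg htg hyD ξ)
  obtain ⟨n, hn⟩ := hev.exists
  exact ⟨hyD, (hx n).2.trans hn⟩

variable [MeasurableSpace Ξ]

theorem measurableSet_learner (hgm : ∀ x, Measurable (g x))
    (htg : ∀ x ∈ D, ∀ ξ, t x ξ = 1 ↔ g x ξ ≤ 0) {x : Feat d} (hx : x ∈ D) :
    MeasurableSet {ξ | t x ξ = 1} := by
  simp only [htg x hx]
  exact measurableSet_le (hgm x) measurable_const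

theorem measurableSet_le_freq {A : Set Ξ} (hA : MeasurableSet A) (r : ℝ) (N : ℕ) :
    MeasurableSet {ξ : Fin N → Ξ | r ≤ freq A ξ} :=
  measurableSet_le measurable_const (measurable_freq hA)

/-- Reverse Fatou: the limsup of the events `S n` has probability at least `1 - α`, and upper
semicontinuity of the score puts it inside the event at the limit point. -/
theorem isClosed_robustSet (hD : IsClosed D) (hg : ∀ ξ, Continuous fun x => g x ξ)
    (hgm : ∀ x, Measurable (g x)) (htg : ∀ x ∈ D, ∀ ξ, t x ξ = 1 ↔ g x ξ ≤ 0)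
    (P : Measure Ξ) [IsProbabilityMeasure P] (α : ℝ) (N : ℕ) :
    IsClosed (robustSet P t D α N) := by
  refine IsSeqClosed.isClosed fun x y hx hxy => ?_
  have hyD : y ∈ D := hD.mem_of_tendsto hxy (Eventually.of_forall fun n => (hx n).1)
  refine ⟨hyD, ?_⟩
  set Q := Measure.pi (fun _ : Fin N => P)
  set S : ℕ → Set (Fin N → Ξ) := fun n => {ξ | ensemble t (x n) ξ = 1}
  have hS : ∀ n, MeasurableSet (S n) := fun n => by
    simp only [S, setOf_ensemble_eq_one]
    exact measurableSet_le_freq (measurableSet_learner hgm htg (hx n).1) _ _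
  set T : ℕ → Set (Fin N → Ξ) := fun k => ⋃ n ≥ k, S n
  have hT : ∀ k, MeasurableSet (T k) := fun k =>
    MeasurableSet.biUnion (Set.to_countable _) fun n _ => hS n
  have hanti : Antitone T := fun k l hkl =>
    Set.biUnion_subset_biUnion_left fun n (hn : l ≤ n) => hkl.trans hn
  have hlim := (ENNReal.tendsto_toReal (measure_ne_top Q _)).comp
    (tendsto_measure_iInter_atTop (μ := Q) (fun k => (hT k).nullMeasurableSet) hanti
      ⟨0, measure_ne_top _ _⟩)
  have hle : 1 - α ≤ Q.real (⋂ k, T k) := by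
    refine ge_of_tendsto' hlim fun k => (hx k).2.trans ?_
    exact measureReal_mono (Set.subset_iUnion₂_of_subset k le_rfl subset_rfl) (measure_ne_top Q _)
  refine hle.trans (measureReal_mono fun ξ hξ => ?_)
  have hev := (tendsto_nhdsWithin_iff.2 ⟨hxy, Eventually.of_forall fun n => (hx n).1⟩).eventually
    (eventually_score_le hg htg hyD ξ)
  obtain ⟨k, hk⟩ := eventually_atTop.1 hev
  obtain ⟨n, hn, hξn⟩ := Set.mem_iUnion₂.1 (Set.mem_iInter.1 hξ k)
  rw [setOf_ensemble_eq_one, Set.mem_ofPred_eq, ← score_eq_freq]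
  simp only [S, setOf_ensemble_eq_one, Set.mem_ofPred_eq, ← score_eq_freq] at hξn
  exact hξn.trans (hk n hn)

/-- The learners that predict the target class somewhere near `x` are covered by an event whose
probability is arbitrarily close to that of predicting the target class at `x`. -/
theorem exists_nhds_learner_subset (hg : ∀ ξ, Continuous fun x => g x ξ)
    (hgm : ∀ x, Measurable (g x)) (htg : ∀ x ∈ D, ∀ ξ, t x ξ = 1 ↔ g x ξ ≤ 0)
    (P : Measure Ξ) [IsProbabilityMeasure P] {x : Feat d} (hx : x ∈ D) {r : ℝ}
    (hr : learnerProb P t x < r) :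
    ∃ U ∈ 𝓝 x, IsOpen U ∧ ∃ A : Set Ξ, MeasurableSet A ∧ P.real A < r ∧
      ∀ y ∈ U, y ∈ D → {ξ | t y ξ = 1} ⊆ A := by
  obtain ⟨Q, hQc, hQd⟩ := TopologicalSpace.exists_countable_dense (Feat d)
  set ε : ℕ → ℝ := fun n => 1 / ((n : ℝ) + 1)
  have hε : ∀ n, 0 < ε n := fun n => by positivity
  have hεlim : Tendsto ε atTop (𝓝 0) := tendsto_one_div_add_atTop_nhds_zero_nat
  have hεanti : Antitone ε := fun m n hmn => by
    simp only [ε]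
    gcongr
  -- Countability of `Q` keeps the union measurable; the slack `ε n` makes the condition open, so
  -- that points of `Q` detect acceptance anywhere in the ball.
  set A : ℕ → Set Ξ := fun n => ⋃ q ∈ Q ∩ Metric.ball x (ε n), {ξ | g q ξ < ε n}
  have hA : ∀ n, MeasurableSet (A n) := fun n =>
    MeasurableSet.biUnion (hQc.mono Set.inter_subset_left) fun q _ =>
      measurableSet_lt (hgm q) measurable_const
  have hmemA : ∀ n ξ, ξ ∈ A n ↔ ∃ q, (q ∈ Q ∧ dist q x < ε n) ∧ g q ξ < ε n := fun n ξ => by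
    simp [A]
  have hanti : Antitone A := fun m n hmn ξ hξ => by
    rw [hmemA] at hξ ⊢
    obtain ⟨q, ⟨hq, hd⟩, hlt⟩ := hξ
    exact ⟨q, ⟨hq, hd.trans_le (hεanti hmn)⟩, hlt.trans_le (hεanti hmn)⟩
  have hlim := (ENNReal.tendsto_toReal (measure_ne_top P _)).comp
    (tendsto_measure_iInter_atTop (μ := P) (fun n => (hA n).nullMeasurableSet) hanti
      ⟨0, measure_ne_top _ _⟩)
  have hinter : (⋂ n, A n) ⊆ {ξ | t x ξ = 1} := by
    intro ξ hξ
    have : ∀ n, ∃ q, (q ∈ Q ∧ dist q x < ε n) ∧ g q ξ < ε n := fun n =>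
      (hmemA n ξ).1 (Set.mem_iInter.1 hξ n)
    choose q hq hlt using this
    have hqx : Tendsto q atTop (𝓝 x) := tendsto_iff_dist_tendsto_zero.2
      (squeeze_zero (fun _ => dist_nonneg) (fun n => (hq n).2.le) hεlim)
    exact (htg x hx ξ).2 (le_of_tendsto_of_tendsto' (((hg ξ).tendsto x).comp hqx) hεlim
      fun n => (hlt n).le)
  obtain ⟨n, hn⟩ := (hlim.eventually
    (Iio_mem_nhds ((measureReal_mono hinter).trans_lt hr : P.real (⋂ n, A n) < r))).exists
  refine ⟨Metric.ball x (ε n), Metric.ball_mem_nhds _ (hε n), Metric.isOpen_ball, A n, hA n, hn, ?_⟩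
  intro y hy hyD ξ hξ
  rw [hmemA]
  have hopen : IsOpen (Metric.ball x (ε n) ∩ {z | g z ξ < ε n}) :=
    Metric.isOpen_ball.inter (isOpen_lt (hg ξ) continuous_const)
  obtain ⟨q, ⟨hq1, hq2⟩, hqQ⟩ := hQd.inter_open_nonempty _ hopen
    ⟨y, hy, ((htg y hyD ξ).1 hξ).trans_lt (hε n)⟩
  exact ⟨q, ⟨hqQ, hq1⟩, hq2⟩

theorem eventually_mem_robustSet (hgm : ∀ x, Measurable (g x))
    (htg : ∀ x ∈ D, ∀ ξ, t x ξ = 1 ↔ g x ξ ≤ 0) (P : Measure Ξ) [IsProbabilityMeasure P]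
    {α : ℝ} (hα : 0 < α) {x : Feat d} (hx : x ∈ D) (hp : 1 / 2 < learnerProb P t x) :
    ∀ᶠ N in atTop, x ∈ robustSet P t D α N := by
  have hA := measurableSet_learner hgm htg hx
  have hE : ∀ N, MeasurableSet {ξ : Fin N → Ξ | 1 / 2 ≤ freq {ζ | t x ζ = 1} ξ}ᶜ :=
    fun N => (measurableSet_le_freq hA _ N).compl
  have hlim := tendsto_pi_of_ae_eventually_notMem P hE (by
    filter_upwards [tendsto_freq (hasLaw_eval_infinitePi P) (iIndepFun_eval_infinitePi P) hA]
      with ζ hζ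
    filter_upwards [hζ.eventually (Ioi_mem_nhds hp)] with N hN
    simpa using le_of_lt hN)
  filter_upwards [hlim.eventually (Iio_mem_nhds hα)] with N hN
  refine ⟨hx, ?_⟩
  rw [probReal_compl_eq_one_sub (measurableSet_le_freq hA _ N)] at hN
  rw [setOf_ensemble_eq_one]
  linarith

theorem eventually_notMem_robustSet (hg : ∀ ξ, Continuous fun x => g x ξ)
    (hgm : ∀ x, Measurable (g x)) (htg : ∀ x ∈ D, ∀ ξ, t x ξ = 1 ↔ g x ξ ≤ 0)
    (P : Measure Ξ) [IsProbabilityMeasure P] {α : ℝ} (hα : α < 1) {x : Feat d} (hx : x ∈ D)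
    (hp : learnerProb P t x < 1 / 2) :
    ∃ U ∈ 𝓝 x, ∀ᶠ N in atTop, ∀ y ∈ U, y ∉ robustSet P t D α N := by
  obtain ⟨U, hU, -, A, hA, hPA, hsub⟩ := exists_nhds_learner_subset hg hgm htg P hx hp
  refine ⟨U, hU, ?_⟩
  have hlim := tendsto_pi_of_ae_eventually_notMem P (measurableSet_le_freq hA (1 / 2)) (by
    filter_upwards [tendsto_freq (hasLaw_eval_infinitePi P) (iIndepFun_eval_infinitePi P) hA]
      with ζ hζ
    filter_upwards [hζ.eventually (Iio_mem_nhds hPA)] with N hN using not_le.2 hN)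
  filter_upwards [hlim.eventually (Iio_mem_nhds (sub_pos.2 hα))] with N hN y hy hyR
  refine absurd (hyR.2.trans ?_) (not_le.2 hN)
  rw [setOf_ensemble_eq_one]
  exact measureReal_mono fun ξ hξ => le_trans hξ (freq_mono fun i hi => hsub y hy hyR.1 hi)

variable {Ω : Type*} [MeasurableSpace Ω]

theorem ae_eventually_mem_saaSet (hgm : ∀ x, Measurable (g x))
    (htg : ∀ x ∈ D, ∀ ξ, t x ξ = 1 ↔ g x ξ ≤ 0) {P : Measure Ξ} {α : ℝ} (hα0 : 0 < α)
    (hα1 : α < 1) {μ : Measure Ω} [IsProbabilityMeasure μ] {ξ₀ : ℕ → Ω → Ξ}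
    (hlaw : ∀ i, HasLaw (ξ₀ i) P μ) (hindep : iIndepFun ξ₀ μ) {x : Feat d} (hx : x ∈ D)
    (hp : 1 / 2 < learnerProb P t x) :
    ∀ᵐ ω ∂μ, ∀ᶠ N in atTop, x ∈ saaSet t D α (fun i => ξ₀ i ω) N := by
  filter_upwards [tendsto_freq hlaw hindep (measurableSet_learner hgm htg hx)] with ω hω
  filter_upwards [(tendsto_pStar hα0 hα1).eventually_lt hω hp] with N hN
  exact ⟨hx, by rw [score_eq_freq]; exact hN.le⟩

/-- The null set must not depend on `x`. By the Lindelöf property countably many neighbourhoods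
cover the points with `p < 1/2`, so countably many laws of large numbers suffice. -/
theorem ae_eventually_notMem_saaSet (hg : ∀ ξ, Continuous fun x => g x ξ)
    (hgm : ∀ x, Measurable (g x)) (htg : ∀ x ∈ D, ∀ ξ, t x ξ = 1 ↔ g x ξ ≤ 0)
    {P : Measure Ξ} [IsProbabilityMeasure P] {α : ℝ} (hα0 : 0 < α) (hα1 : α < 1)
    {μ : Measure Ω} [IsProbabilityMeasure μ] {ξ₀ : ℕ → Ω → Ξ}
    (hlaw : ∀ i, HasLaw (ξ₀ i) P μ) (hindep : iIndepFun ξ₀ μ) :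
    ∀ᵐ ω ∂μ, ∀ x ∈ D, learnerProb P t x < 1 / 2 →
      ∃ U ∈ 𝓝 x, ∀ᶠ N in atTop, ∀ y ∈ U, y ∉ saaSet t D α (fun i => ξ₀ i ω) N := by
  have hex : ∀ x, ∃ (U : Set (Feat d)) (A : Set Ξ), x ∈ D → learnerProb P t x < 1 / 2 →
      U ∈ 𝓝 x ∧ IsOpen U ∧ MeasurableSet A ∧ P.real A < 1 / 2 ∧
      ∀ y ∈ U, y ∈ D → {ξ | t y ξ = 1} ⊆ A := by
    intro x
    by_cases h : x ∈ D ∧ learnerProb P t x < 1 / 2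
    · obtain ⟨U, hU, hUo, A, hA⟩ := exists_nhds_learner_subset hg hgm htg P h.1 h.2
      exact ⟨U, A, fun _ _ => ⟨hU, hUo, hA⟩⟩
    · exact ⟨∅, ∅, fun h1 h2 => absurd ⟨h1, h2⟩ h⟩
  choose U A hUA using hex
  obtain ⟨C, hCs, hCc, hcov⟩ := TopologicalSpace.countable_cover_nhdsWithin
    (s := {x | x ∈ D ∧ learnerProb P t x < 1 / 2}) (f := U)
    fun x hx => mem_nhdsWithin_of_mem_nhds (hUA x hx.1 hx.2).1
  have hae : ∀ᵐ ω ∂μ, ∀ z ∈ C, Tendsto (fun N : ℕ => freq (A z) (fun i : Fin N => ξ₀ i ω)) atTop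
      (𝓝 (P.real (A z))) :=
    (ae_ball_iff hCc).2 fun z hz =>
      tendsto_freq hlaw hindep (hUA z (hCs hz).1 (hCs hz).2).2.2.1
  filter_upwards [hae] with ω hω x hx hp
  obtain ⟨z, hzC, hxz⟩ := Set.mem_iUnion₂.1 (hcov (show _ ∧ _ from ⟨hx, hp⟩))
  obtain ⟨-, hUo, -, hPA, hsub⟩ := hUA z (hCs hzC).1 (hCs hzC).2
  refine ⟨U z, hUo.mem_nhds hxz, ?_⟩
  filter_upwards [(hω z hzC).eventually_lt (tendsto_pStar hα0 hα1) hPA] with N hN y hy hyS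
  refine absurd hyS.2 (not_le.2 (lt_of_le_of_lt ?_ hN))
  rw [score_eq_freq]
  exact freq_mono fun i hi => hsub y hy hyS.1 hi

end Learner

end RobustCE

theorem proposition4 {d : ℕ} {Ξ Ω : Type*} [MeasurableSpace Ξ] [MeasurableSpace Ω]
    -- the law of the random training parameter of one base learner
    (P : Measure Ξ) [IsProbabilityMeasure P]
    -- the feature space, the actionable domain and the plausible domain
    (𝒳 Xa Xp : Set (RobustCE.Feat d)) (hXa : Xa ⊆ 𝒳) (hXp : Xp ⊆ 𝒳)
    (hclosed : IsClosed (Xa ∩ Xp))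
    -- the convex base learner
    (t : RobustCE.Feat d → Ξ → Fin 2) (ht : RobustCE.IsConvexLearner 𝒳 t)
    -- the cost of a counterfactual explanation of the observation `xnew`
    (f : RobustCE.Feat d → RobustCE.Feat d → ℝ) (xnew : RobustCE.Feat d)
    (hf : ContinuousOn (fun x => f x xnew) (Xa ∩ Xp))
    (hfb : ∀ c : ℝ, Bornology.IsBounded {x | x ∈ Xa ∩ Xp ∧ f x xnew ≤ c})
    -- the tolerance
    (α : ℝ) (hα0 : 0 < α) (hα1 : α < 1)
    -- the training parameters of the base learners of the given ensembles: an i.i.d. sequence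
    (μ : Measure Ω) [IsProbabilityMeasure μ] (ξ₀ : ℕ → Ω → Ξ)
    (hlaw : ∀ i, HasLaw (ξ₀ i) P μ) (hindep : iIndepFun ξ₀ μ)
    -- regularity: some optimal solution of the limit problem is a limit of strictly feasible points
    (hreg : ∃ x ∈ RobustCE.argmin (fun x => f x xnew) (RobustCE.limitSet P t (Xa ∩ Xp)),
      x ∈ closure {y | y ∈ Xa ∩ Xp ∧ 1 / 2 < RobustCE.learnerProb P t y}) :
    Tendsto (fun N => RobustCE.pStar N α) atTop (𝓝 (1 / 2)) ∧
    (∀ᶠ N in atTop, (RobustCE.argmin (fun x => f x xnew)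
      (RobustCE.robustSet P t (Xa ∩ Xp) α N)).Nonempty) ∧
    ∀ᵐ ω ∂μ,
      (∀ᶠ N in atTop, (RobustCE.argmin (fun x => f x xnew)
        (RobustCE.saaSet t (Xa ∩ Xp) α (fun i => ξ₀ i ω) N)).Nonempty) ∧
      ∀ xhat xrob : ℕ → RobustCE.Feat d,
        (∀ᶠ N in atTop, xhat N ∈ RobustCE.argmin (fun x => f x xnew)
          (RobustCE.saaSet t (Xa ∩ Xp) α (fun i => ξ₀ i ω) N)) →
        (∀ᶠ N in atTop, xrob N ∈ RobustCE.argmin (fun x => f x xnew)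
          (RobustCE.robustSet P t (Xa ∩ Xp) α N)) →
        Tendsto (fun N => f (xhat N) xnew - f (xrob N) xnew) atTop (𝓝 0) ∧
        Tendsto (fun N => Metric.infDist (xhat N) (RobustCE.argmin (fun x => f x xnew)
          (RobustCE.limitSet P t (Xa ∩ Xp)))) atTop (𝓝 0) ∧
        Tendsto (fun N => Metric.infDist (xrob N) (RobustCE.argmin (fun x => f x xnew)
          (RobustCE.limitSet P t (Xa ∩ Xp)))) atTop (𝓝 0) ∧
        ((RobustCE.argmin (fun x => f x xnew)
            (RobustCE.limitSet P t (Xa ∩ Xp))).Subsingleton →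
          Tendsto (fun N => dist (xhat N) (xrob N)) atTop (𝓝 0)) := by
  obtain ⟨g, hconv, hgm, htg'⟩ := ht
  have hg : ∀ ξ, Continuous fun x => g x ξ := fun ξ =>
    continuousOn_univ.1 ((hconv ξ).continuousOn isOpen_univ)
  have htg : ∀ x ∈ Xa ∩ Xp, ∀ ξ, t x ξ = 1 ↔ g x ξ ≤ 0 := fun x hx => htg' x (hXa hx.1)
  clear htg' hconv
  set D := Xa ∩ Xp
  obtain ⟨xbar, hxbar, hcl⟩ := hreg
  have hLD : RobustCE.limitSet P t D ⊆ D := fun x hx => hx.1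
  have hnotL : ∀ x ∈ D, x ∉ RobustCE.limitSet P t D → RobustCE.learnerProb P t x < 1 / 2 :=
    fun x hx hL => not_le.1 fun h => hL ⟨hx, h⟩
  have hsub : {y | y ∈ D ∧ 1 / 2 < RobustCE.learnerProb P t y} ⊆
      {y | y ∈ D ∧ ∀ᶠ N in atTop, y ∈ RobustCE.robustSet P t D α N} := fun y hy =>
    ⟨hy.1, RobustCE.eventually_mem_robustSet hgm htg P hα0 hy.1 hy.2⟩
  have hrob := RobustCE.argmin_consistent hclosed hf hfb
    (F := RobustCE.robustSet P t D α) (fun N x hx => hx.1)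
    (RobustCE.isClosed_robustSet hclosed hg hgm htg P α) hLD hxbar
    (closure_mono hsub hcl)
    fun x hx hL => RobustCE.eventually_notMem_robustSet hg hgm htg P hα1 hx (hnotL x hx hL)
  refine ⟨RobustCE.tendsto_pStar hα0 hα1, hrob.1, ?_⟩
  -- A sequence of strictly feasible points replaces the whole set, so that a single null set serves
  -- them all.
  obtain ⟨y, hy, hylim⟩ := mem_closure_iff_seq_limit.1 hcl
  have hmem : ∀ᵐ ω ∂μ, ∀ k, ∀ᶠ N in atTop,
      y k ∈ RobustCE.saaSet t D α (fun i => ξ₀ i ω) N :=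
    ae_all_iff.2 fun k =>
      RobustCE.ae_eventually_mem_saaSet hgm htg hα0 hα1 hlaw hindep (hy k).1 (hy k).2
  filter_upwards [hmem, RobustCE.ae_eventually_notMem_saaSet hg hgm htg hα0 hα1 hlaw hindep]
    with ω hin hout
  have hsaa := RobustCE.argmin_consistent hclosed hf hfb
    (F := RobustCE.saaSet t D α (fun i => ξ₀ i ω)) (fun N x hx => hx.1)
    (fun N => RobustCE.isClosed_le_score hclosed hg htg _ _) hLD hxbar
    (mem_closure_of_tendsto hylim (Eventually.of_forall fun k => ⟨(hy k).1, hin k⟩))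
    fun x hx hL => hout x hx (hnotL x hx hL)
  refine ⟨hsaa.1, fun xhat xrob hxhat hxrob => ?_⟩
  obtain ⟨hhat1, hhat2⟩ := hsaa.2 xhat hxhat
  obtain ⟨hrob1, hrob2⟩ := hrob.2 xrob hxrob
  refine ⟨by simpa using hhat1.sub hrob1, hhat2, hrob2, fun hS => ?_⟩
  -- The distance to the solution set becomes the distance to `xbar`.
  rw [hS.eq_singleton_of_mem hxbar] at hhat2 hrob2
  simp only [Metric.infDist_singleton] at hhat2 hrob2
  refine squeeze_zero (fun _ => dist_nonneg) (fun N => dist_triangle_right _ _ xbar) ?_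
  simpa using hhat2.add hrob2
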